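/- Let $0<\psi<\phi<\frac{\pi}{2}$ be fixed. For $x,y$ in the unit sphere $\mathbb{S}^{n-1}=\{x\in\mathbb{R}^n:\|x\|=1\}$ let $\theta(x,y)=\arccos(x\cdot y)$ be the angle between $x$ and $y$, and let $C(x,\alpha)=\{y\in\mathbb{S}^{n-1}:\theta(x,y)\le\alpha\}$ be the spherical cap centered at $x$ of angular radius $\alpha$. Then there exist a real sequence $(\varepsilon_n)_{n\ge1}$ with $\varepsilon_n\to0$ as $n\to\infty$ and a constant $c$, both depending only on $\psi$ and $\phi$, such that for every positive integer $n$ there is a non-empty finite collection $X=\{x_1,\dots,x_N\}\subset\mathbb{S}^{n-1}$ with $$N=\left(\frac{1+\varepsilon_n}{\sin\phi}\right)^n$$ satisfying (a) $\psi\le\theta(x_i,x_j)\le\pi-\psi$ for all $1\le i<j\le N$; and (b) if $n\ge2$, every point of $\mathbb{S}^{n-1}$ is contained in at most $c\,n\log n$ of the spherical caps $C(x_i,\phi)$, $1\le i\le N$. -/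

import Mathlib

open Filter Topology

/-- The unit sphere `S^{n-1}` of the Euclidean space `ℝⁿ`, as a type. -/
abbrev UnitSphere (n : ℕ) : Type := Metric.sphere (0 : EuclideanSpace ℝ (Fin n)) 1

/-- The geodesic distance between two points of the unit sphere: the angle
`arccos (⟪x, y⟫ / (‖x‖ * ‖y‖))`. -/
noncomputable def sphereAngle {n : ℕ} (x y : UnitSphere n) : ℝ :=
  InnerProductGeometry.angle (x : EuclideanSpace ℝ (Fin n)) (y : EuclideanSpace ℝ (Fin n))

/-- The closed spherical cap with centre `x` and angular radius `α`. -/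
def sphericalCap {n : ℕ} (x : UnitSphere n) (α : ℝ) : Set (UnitSphere n) :=
  {y | sphereAngle x y ≤ α}

open MeasureTheory Metric Module InnerProductGeometry

/-! Points are chosen greedily by volume in a shell `t ≤ ‖z‖ ≤ 1`, then normalised. The shell has at
least half the volume of the unit ball, and its part in a cone of half-angle `α` has relative volume
at most `sin α ^ n`. So few directions are lost to the angle condition. Multiplicities are
controlled by a potential: the sum over an exponentially large net of `R ^ (n * multiplicity)`, with
`R > 1`. By averaging, some allowed point raises it by a factor close to 1. After `T ≤ β ^ n` steps,
`β < 1 / sin φ`, it is still at most `D ^ n`, so every multiplicity is at most the constant `log D /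
log R`. This constant depends on `β`, but `n log n` eventually exceeds it. Hence the largest
admissible `N ≤ (1 / sin φ) ^ n` satisfies `N ^ (1 / n) → 1 / sin φ`, which gives `ε`. -/

/-! ### Greedy selection with an exponential potential -/

/-- Averaging: a nonnegative combination of indicators of small sets is small at some point of
a large set. -/
theorem exists_mem_sum_indicator_le {Ω ι : Type*} [MeasurableSpace Ω] (μ : Measure Ω)
    [IsFiniteMeasure μ] {G : Set Ω} {m s : ℝ} (hm : 0 < m)
    (hGm : m / 2 ≤ μ.real G) (P : Finset ι) (C : ι → Set Ω) (hC : ∀ p, MeasurableSet (C p))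
    (hs : ∀ p, μ.real (C p) ≤ s * m) (w : ι → ℝ) (hw : ∀ p, 0 ≤ w p) :
    ∃ x ∈ G, ∑ p ∈ P, (C p).indicator (fun _ => w p) x ≤ 2 * s * ∑ p ∈ P, w p := by
  have hGpos : 0 < μ.real G := by linarith
  have hG0 : μ G ≠ 0 := fun h => by simp [Measure.real, h] at hGpos
  have hint : ∀ p ∈ P, Integrable ((C p).indicator (fun _ => w p)) μ := fun p _ =>
    (integrable_const (w p)).indicator (hC p)
  have hsum : Integrable (fun x => ∑ p ∈ P, (C p).indicator (fun _ => w p) x) μ :=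
    integrable_finsetSum P hint
  have hnn : ∀ x, 0 ≤ ∑ p ∈ P, (C p).indicator (fun _ => w p) x := fun x =>
    Finset.sum_nonneg fun p _ => Set.indicator_nonneg (fun _ _ => hw p) x
  obtain ⟨x, hx, hle⟩ := exists_le_setAverage hG0 (measure_ne_top μ G) hsum.integrableOn
  refine ⟨x, hx, hle.trans ?_⟩
  rw [setAverage_eq, smul_eq_mul, inv_mul_le_iff₀ hGpos]
  have h1 : ∫ x in G, ∑ p ∈ P, (C p).indicator (fun _ => w p) x ∂μ ≤ s * m * ∑ p ∈ P, w p := by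
    refine (setIntegral_le_integral hsum (Eventually.of_forall hnn)).trans ?_
    rw [integral_finsetSum P hint, Finset.mul_sum]
    refine Finset.sum_le_sum fun p _ => ?_
    rw [integral_indicator_const _ (hC p), smul_eq_mul]
    exact mul_le_mul_of_nonneg_right (hs p) (hw p)
  have hsw : 0 ≤ s * ∑ p ∈ P, w p := by
    rw [Finset.mul_sum]
    refine Finset.sum_nonneg fun p _ => mul_nonneg ?_ (hw p)
    exact nonneg_of_mul_nonneg_left (measureReal_nonneg.trans (hs p)) hm
  nlinarith

/-- Greedy selection of points avoiding the sets `B (x i)` attached to the previous choices, while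
keeping an exponential potential of the multiplicities under control. -/
theorem exists_greedy_family {Ω ι : Type*} [MeasurableSpace Ω] (μ : Measure Ω)
    [IsFiniteMeasure μ] {A : Set Ω} {m s b M : ℝ} (hm : 0 < m)
    (hA : m ≤ μ.real A) (P : Finset ι) (C : ι → Set Ω) (hC : ∀ p, MeasurableSet (C p))
    (hs : ∀ p, μ.real (C p) ≤ s * m) (hs0 : 0 ≤ s) (B : Ω → Set Ω)
    (hb : ∀ x, μ.real (B x) ≤ b * m) (hb0 : 0 ≤ b) (hM : 1 ≤ M)
    (T : ℕ) (hT : T * b ≤ 1 / 2) :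
    ∃ x : Fin T → Ω, (∀ i, x i ∈ A) ∧ (∀ i j, i < j → x j ∉ B (x i)) ∧
      ∑ p ∈ P, M ^ {i | x i ∈ C p}.ncard ≤ P.card * (1 + 2 * (M - 1) * s) ^ T := by
  classical
  have hcard : ∀ (T : ℕ) (x : Fin T → Ω) (p : ι),
      M ^ {i | x i ∈ C p}.ncard = ∏ i, if x i ∈ C p then M else 1 := by
    intro T x p
    rw [Set.ncard_eq_toFinset_card', ← Finset.prod_filter, Finset.prod_const]
    congr 2
    ext i
    simp
  simp only [hcard]
  induction T with
  | zero => exact ⟨Fin.elim0, fun i => i.elim0, fun i => i.elim0, by simp⟩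
  | succ T ih =>
    push_cast at hT
    obtain ⟨x, hxA, hxB, hx⟩ := ih (by linarith)
    set w : ι → ℝ := fun p => ∏ i, if x i ∈ C p then M else 1 with hw
    have hw0 : ∀ p, 0 ≤ w p := fun p => Finset.prod_nonneg fun i _ => by split_ifs <;> linarith
    have hG : m / 2 ≤ μ.real (A \ ⋃ i, B (x i)) := by
      have h1 : μ.real (⋃ i, B (x i)) ≤ T * (b * m) := by
        refine (measureReal_iUnion_fintype_le _).trans ?_
        refine (Finset.sum_le_sum fun i _ => hb (x i)).trans ?_
        simp
      have h2 := le_measureReal_sdiff (μ := μ) (s₁ := A) (s₂ := ⋃ i, B (x i))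
      nlinarith
    obtain ⟨z, hz, hzle⟩ := exists_mem_sum_indicator_le μ hm hG P C hC hs w hw0
    refine ⟨Fin.snoc x z, ?_, ?_, ?_⟩
    · intro i
      refine Fin.lastCases ?_ (fun i => ?_) i
      · simpa using hz.1
      · simpa using hxA i
    · intro i j
      refine Fin.lastCases ?_ (fun j => ?_) j
      · refine Fin.lastCases ?_ (fun i => ?_) i
        · simp
        · intro _
          have := hz.2
          simp only [Set.mem_iUnion, not_exists] at this
          simpa using this i
      · refine Fin.lastCases ?_ (fun i => ?_) i
        · intro h
          exact absurd h (not_lt.2 (Fin.le_last _))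
        · intro h
          simpa using hxB i j (by simpa using h)
    · have key : ∑ p ∈ P, ∏ i, (if (Fin.snoc x z : Fin (T + 1) → Ω) i ∈ C p then M else 1)
          = ∑ p ∈ P, w p + (M - 1) * ∑ p ∈ P, (C p).indicator (fun _ => w p) z := by
        rw [Finset.mul_sum, ← Finset.sum_add_distrib]
        refine Finset.sum_congr rfl fun p _ => ?_
        rw [Fin.prod_univ_castSucc]
        simp only [Fin.snoc_castSucc, Fin.snoc_last, Set.indicator_apply]
        change w p * _ = _
        split_ifs <;> ring
      rw [key, pow_succ, ← mul_assoc]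
      have h3 : 0 ≤ (M - 1) := by linarith
      calc _ ≤ ∑ p ∈ P, w p + (M - 1) * (2 * s * ∑ p ∈ P, w p) := by gcongr
        _ = (∑ p ∈ P, w p) * (1 + 2 * (M - 1) * s) := by ring
        _ ≤ _ := by gcongr

/-! ### Separated sets and nets -/

/-- The volumetric bound on the size of a separated set in the unit ball. -/
theorem card_le_pow_of_separated {E : Type*} [NormedAddCommGroup E] [NormedSpace ℝ E]
    [FiniteDimensional ℝ E] [MeasurableSpace E] [BorelSpace E] {ρ : ℝ} (hρ : 0 < ρ)
    (s : Finset E) (hs : ∀ c ∈ s, ‖c‖ ≤ 1) (h : ∀ c ∈ s, ∀ d ∈ s, c ≠ d → ρ ≤ dist c d) :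
    (s.card : ℝ) ≤ (1 + 2 / ρ) ^ finrank ℝ E := by
  let μ : Measure E := Measure.addHaar
  have hV : 0 < μ.real (ball (0 : E) 1) :=
    ENNReal.toReal_pos (measure_ball_pos _ _ zero_lt_one).ne' measure_ball_lt_top.ne
  have hball : ∀ (c : E) {r : ℝ}, 0 < r →
      μ.real (ball c r) = r ^ finrank ℝ E * μ.real (ball (0 : E) 1) := by
    intro c r hr
    rw [Measure.real, Measure.addHaar_ball_of_pos μ c hr, ENNReal.toReal_mul,
      ENNReal.toReal_ofReal (by positivity), Measure.real]
  have hD : Set.PairwiseDisjoint (s : Set E) (fun c => ball c (ρ / 2)) := by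
    intro c hc d hd hcd
    apply ball_disjoint_ball
    linarith [h c hc d hd hcd]
  have hsub : (⋃ c ∈ s, ball c (ρ / 2)) ⊆ ball (0 : E) (1 + ρ / 2) := by
    refine Set.iUnion₂_subset fun x hx => ball_subset_ball' ?_
    rw [dist_zero_right]
    linarith [hs x hx]
  have h1 : (s.card : ℝ) * ((ρ / 2) ^ finrank ℝ E * μ.real (ball (0 : E) 1)) ≤
      (1 + ρ / 2) ^ finrank ℝ E * μ.real (ball (0 : E) 1) := by
    rw [← hball 0 (by positivity : 0 < 1 + ρ / 2)]
    refine le_trans (le_of_eq ?_) (measureReal_mono hsub measure_ball_lt_top.ne)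
    rw [measureReal_biUnion_finset hD fun c _ => measurableSet_ball,
      Finset.sum_congr rfl fun c _ => hball c (by positivity : 0 < ρ / 2)]
    simp
  have h2 : (s.card : ℝ) * (ρ / 2) ^ finrank ℝ E ≤ (1 + ρ / 2) ^ finrank ℝ E :=
    le_of_mul_le_mul_right (by linarith) hV
  have h3 : (1 + 2 / ρ) = (1 + ρ / 2) / (ρ / 2) := by field_simp; ring
  rwa [h3, div_pow, le_div_iff₀ (by positivity)]

/-- Subsets of the unit ball of dimension `n` have nets of size at most `(1 + 2 / ρ) ^ n`. -/
theorem exists_finset_net {E : Type*} [NormedAddCommGroup E] [NormedSpace ℝ E]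
    [FiniteDimensional ℝ E] [MeasurableSpace E] [BorelSpace E] {ρ : ℝ} (hρ : 0 < ρ)
    (S : Set E) (hS : ∀ c ∈ S, ‖c‖ ≤ 1) :
    ∃ P : Finset E, ↑P ⊆ S ∧ (P.card : ℝ) ≤ (1 + 2 / ρ) ^ finrank ℝ E ∧
      ∀ y ∈ S, ∃ p ∈ P, dist y p < ρ := by
  classical
  let Q : ℕ → Prop := fun k => ∃ P : Finset E, P.card = k ∧ ↑P ⊆ S ∧
    ∀ c ∈ P, ∀ d ∈ P, c ≠ d → ρ ≤ dist c d
  have hbound : ∀ k, Q k → k ≤ ⌊(1 + 2 / ρ) ^ finrank ℝ E⌋₊ := by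
    rintro _ ⟨P, rfl, hPS, hP⟩
    exact Nat.le_floor (card_le_pow_of_separated hρ P (fun c hc => hS c (hPS hc)) hP)
  have hQ0 : Q 0 := ⟨∅, by simp⟩
  -- A separated set of maximal cardinality is a net.
  obtain ⟨P, hPk, hPS, hP⟩ : Q (Nat.findGreatest Q ⌊(1 + 2 / ρ) ^ finrank ℝ E⌋₊) :=
    Nat.findGreatest_spec (Nat.zero_le _) hQ0
  refine ⟨P, hPS, card_le_pow_of_separated hρ P (fun c hc => hS c (hPS hc)) hP, ?_⟩
  intro y hy
  by_contra! hfar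
  have hyP : y ∉ P := fun h => by have := hfar y h; simp at this; linarith
  have hQ : Q (P.card + 1) := by
    refine ⟨insert y P, Finset.card_insert_of_notMem hyP, ?_, ?_⟩
    · rw [Finset.coe_insert]
      exact Set.insert_subset hy hPS
    · intro c hc d hd hcd
      rw [Finset.mem_insert] at hc hd
      rcases hc with rfl | hc <;> rcases hd with rfl | hd
      · exact absurd rfl hcd
      · exact hfar d hd
      · rw [dist_comm]; exact hfar c hc
      · exact hP c hc d hd hcd
  have := Nat.le_findGreatest (hbound _ hQ) hQ
  omega

/-! ### Volume of cones in a thin shell -/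

section Geometry

variable {E : Type*} [NormedAddCommGroup E] [InnerProductSpace ℝ E]

/-- The part of a cone of half-angle `α` in a thin enough shell lies in a ball of radius
`sin α`. -/
theorem dist_cos_smul_le_sin {x z : E} {α t : ℝ} (hα0 : 0 ≤ α) (hα : α ≤ Real.pi / 2)
    (ht : Real.cos (2 * α) ≤ t) (hx : ‖x‖ = 1) (hzt : t ≤ ‖z‖) (hz1 : ‖z‖ ≤ 1)
    (hxz : angle x z ≤ α) : dist z (Real.cos α • x) ≤ Real.sin α := by
  have hs : 0 ≤ Real.sin α := Real.sin_nonneg_of_nonneg_of_le_pi hα0 (by linarith [Real.pi_pos])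
  have hc : 0 ≤ Real.cos α := Real.cos_nonneg_of_mem_Icc ⟨by linarith, hα⟩
  have hcos : Real.cos α ≤ Real.cos (angle x z) :=
    Real.cos_le_cos_of_nonneg_of_le_pi (angle_nonneg x z) (by linarith [Real.pi_pos]) hxz
  have hin : ‖z‖ * Real.cos α ≤ inner ℝ z x := by
    have := cos_angle_mul_norm_mul_norm x z
    rw [hx, one_mul, real_inner_comm] at this
    rw [← this, mul_comm]
    gcongr
  rw [dist_eq_norm]
  refine le_of_sq_le_sq ?_ hs
  rw [norm_sub_sq_real, norm_smul, hx, inner_smul_right, Real.norm_eq_abs, mul_one, sq_abs,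
    Real.sin_sq]
  rw [Real.cos_two_mul] at ht
  -- With `r = ‖z‖`, the claim reduces to `(r - 1) * (r - cos (2 * α)) ≤ 0`.
  nlinarith [mul_le_mul_of_nonneg_left hin hc,
    mul_nonneg (sub_nonneg.2 hz1) (sub_nonneg.2 (ht.trans hzt))]

theorem angle_le_of_dist_le {x y : E} {δ : ℝ} (hδ0 : 0 ≤ δ)
    (hx : ‖x‖ = 1) (hy : ‖y‖ = 1) (h : dist x y ^ 2 ≤ 2 - 2 * Real.cos δ) : angle x y ≤ δ := by
  rw [dist_eq_norm, norm_sub_sq_real, hx, hy] at h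
  have h1 : Real.cos δ ≤ Real.cos (angle x y) := by
    rw [cos_angle, hx, hy]
    linarith
  by_contra! hlt
  exact absurd h1 (not_le.2 (Real.cos_lt_cos_of_nonneg_of_le_pi hδ0 (angle_le_pi x y) hlt))

theorem measurableSet_angle_le [MeasurableSpace E] [BorelSpace E] [SecondCountableTopology E]
    (x : E) (α : ℝ) : MeasurableSet {z | angle x z ≤ α} := by
  unfold InnerProductGeometry.angle
  apply measurableSet_le <;> fun_prop

/-- The shell of points of norm between `t` and `1`. -/
def normShell (E : Type*) [NormedAddCommGroup E] (t : ℝ) : Set E := closedBall 0 1 \ ball 0 t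

variable [FiniteDimensional ℝ E] [MeasurableSpace E] [BorelSpace E]

theorem measureReal_normShell_ge (μ : Measure E) [μ.IsAddHaarMeasure] {t : ℝ} (ht : 0 < t)
    (h : t ^ finrank ℝ E ≤ 1 / 2) : μ.real (ball (0 : E) 1) / 2 ≤ μ.real (normShell E t) := by
  have h1 := le_measureReal_sdiff (μ := μ) (s₁ := closedBall (0 : E) 1) (s₂ := ball (0 : E) t)
    measure_ball_lt_top.ne
  have h2 : μ.real (ball (0 : E) t) = t ^ finrank ℝ E * μ.real (ball (0 : E) 1) := by
    rw [Measure.real, Measure.addHaar_ball_of_pos μ 0 ht, ENNReal.toReal_mul,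
      ENNReal.toReal_ofReal (by positivity), Measure.real]
  rw [h2, Measure.addHaar_real_closedBall μ 0 zero_le_one, one_pow, one_mul] at h1
  have h3 : 0 ≤ μ.real (ball (0 : E) 1) := measureReal_nonneg
  unfold normShell
  nlinarith

theorem measureReal_restrict_angle_le (μ : Measure E) [μ.IsAddHaarMeasure] {α t : ℝ}
    (hα0 : 0 ≤ α) (hα : α < Real.pi / 2) (ht : Real.cos (2 * α) ≤ t) (x : E) :
    (μ.restrict (normShell E t)).real {z | angle x z ≤ α} ≤
      Real.sin α ^ finrank ℝ E * μ.real (ball (0 : E) 1) := by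
  have hs : 0 ≤ Real.sin α := Real.sin_nonneg_of_nonneg_of_le_pi hα0 (by linarith [Real.pi_pos])
  -- By convention the angle with `0` is `π / 2 > α`, so that cone is empty.
  rcases eq_or_ne x 0 with rfl | hx
  · have : {z : E | angle 0 z ≤ α} = ∅ := by
      ext z
      simpa using hα
    rw [this]
    simp only [measureReal_empty]
    positivity
  · rw [measureReal_restrict_apply (measurableSet_angle_le x α),
      ← Measure.addHaar_real_closedBall μ (Real.cos α • (‖x‖⁻¹ • x)) hs]
    refine measureReal_mono ?_ measure_closedBall_lt_top.ne
    rintro z ⟨hz, hzA, hzt⟩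
    rw [mem_closedBall_zero_iff] at hzA
    rw [mem_ball_zero_iff, not_lt] at hzt
    refine dist_cos_smul_le_sin hα0 hα.le ht (norm_smul_inv_norm hx) hzt hzA ?_
    rw [angle_smul_left_of_pos _ _ (inv_pos.2 (norm_pos_iff.2 hx))]
    exact hz

end Geometry

/-! ### Spread families in a fixed dimension -/

/-- There is a family of `N` points on the sphere with the angle condition at level `ψ` such that
every point lies in at most `κ` of the caps of radius `φ`. -/
def ExistsSpreadFamily (ψ φ : ℝ) (n N : ℕ) (κ : ℝ) : Prop :=
  ∃ x : Fin N → UnitSphere n,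
    (∀ i j : Fin N, i < j →
      ψ ≤ sphereAngle (x i) (x j) ∧ sphereAngle (x i) (x j) ≤ Real.pi - ψ) ∧
    ∀ y : UnitSphere n, (({i : Fin N | y ∈ sphericalCap (x i) φ}.ncard : ℕ) : ℝ) ≤ κ

theorem ExistsSpreadFamily.mono {ψ φ κ κ' : ℝ} {n N : ℕ} (h : ExistsSpreadFamily ψ φ n N κ)
    (hκ : κ ≤ κ') : ExistsSpreadFamily ψ φ n N κ' := by
  obtain ⟨x, h1, h2⟩ := h
  exact ⟨x, h1, fun y => (h2 y).trans hκ⟩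

theorem existsSpreadFamily_one (ψ φ : ℝ) {n : ℕ} (hn : 1 ≤ n) : ExistsSpreadFamily ψ φ n 1 1 := by
  refine ⟨fun _ => ⟨EuclideanSpace.single ⟨0, hn⟩ 1, by simp⟩, fun i j hij => by omega, ?_⟩
  intro y
  have := Set.ncard_le_card
    {i : Fin 1 | y ∈ sphericalCap (⟨EuclideanSpace.single ⟨0, hn⟩ 1, by simp⟩ : UnitSphere n) φ}
  simpa using this

/-- The greedy choice, applied to volume on a thin shell and to caps around a net, produces spread
families in a fixed dimension. -/
theorem existsSpreadFamily_of_bounds {ψ φ δ t R D : ℝ} {n T : ℕ} (hψ : 0 < ψ)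
    (hψφ : ψ < φ) (hδ : 0 < δ) (hφ : φ + δ < Real.pi / 2) (ht0 : 0 < t)
    (ht : Real.cos (2 * ψ) ≤ t) (htn : t ^ n ≤ 1 / 2) (hR : 1 < R)
    (hD : (1 + 2 / √(2 - 2 * Real.cos δ)) * Real.exp 4 ≤ D) (hn : 1 ≤ n)
    (hTψ : T * Real.sin ψ ^ n ≤ 1 / 8) (hTφ : T * (R * Real.sin (φ + δ)) ^ n ≤ 1) :
    ExistsSpreadFamily ψ φ n T (Real.log D / Real.log R) := by
  have hπ := Real.pi_pos
  have hρ : 0 < 2 - 2 * Real.cos δ := by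
    have := Real.cos_lt_cos_of_nonneg_of_le_pi le_rfl (by linarith) hδ
    rw [Real.cos_zero] at this
    linarith
  obtain ⟨P, hPS, hPcard, hPnet⟩ := exists_finset_net (Real.sqrt_pos.2 hρ)
    (sphere (0 : EuclideanSpace ℝ (Fin n)) 1) (fun c hc => (mem_sphere_zero_iff_norm.1 hc).le)
  rw [finrank_euclideanSpace_fin] at hPcard
  let μ : Measure (EuclideanSpace ℝ (Fin n)) := volume
  let A := normShell (EuclideanSpace ℝ (Fin n)) t
  set V := μ.real (ball (0 : EuclideanSpace ℝ (Fin n)) 1)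
  have hVpos : 0 < V :=
    ENNReal.toReal_pos (measure_ball_pos _ _ zero_lt_one).ne' measure_ball_lt_top.ne
  have hsψ : 0 < Real.sin ψ := Real.sin_pos_of_pos_of_lt_pi hψ (by linarith)
  have hsφ : 0 < Real.sin (φ + δ) := Real.sin_pos_of_pos_of_lt_pi (by linarith) (by linarith)
  have hfin : μ A ≠ ⊤ :=
    ((measure_mono Set.sdiff_subset).trans_lt measure_closedBall_lt_top).ne
  have : IsFiniteMeasure (μ.restrict A) := ⟨by simpa using hfin.lt_top⟩
  have hmeas : MeasurableSet A := measurableSet_closedBall.diff measurableSet_ball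
  have hcapψ : ∀ x : EuclideanSpace ℝ (Fin n), (μ.restrict A).real {z | angle x z ≤ ψ} ≤
      Real.sin ψ ^ n * V := by
    intro x
    have := measureReal_restrict_angle_le μ hψ.le (by linarith) ht x
    rwa [finrank_euclideanSpace_fin] at this
  -- The shell only guarantees volume `V / 2`, hence the factor 2 in `s`; `b` has another 2 because
  -- the cap around `-x` is excluded too, for the bound `π - ψ`.
  obtain ⟨x, hxA, hxB, hx⟩ := exists_greedy_family (μ.restrict A)
    (A := A) (m := V / 2) (s := 2 * Real.sin (φ + δ) ^ n) (b := 4 * Real.sin ψ ^ n)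
    (M := R ^ n) (by positivity)
    (by
      rw [measureReal_restrict_apply hmeas, Set.inter_self]
      exact measureReal_normShell_ge μ ht0 (by rwa [finrank_euclideanSpace_fin]))
    P (fun p => {z | angle p z ≤ φ + δ}) (fun p => measurableSet_angle_le p _)
    (by
      intro p
      have hcos : Real.cos (2 * (φ + δ)) ≤ t :=
        (Real.cos_le_cos_of_nonneg_of_le_pi (by linarith) (by linarith) (by linarith)).trans ht
      have := measureReal_restrict_angle_le μ (by linarith) hφ hcos p
      rw [finrank_euclideanSpace_fin] at this
      linarith)
    (by positivity)
    (fun x => {z | angle x z ≤ ψ} ∪ {z | angle (-x) z ≤ ψ})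
    (by
      intro x
      refine (measureReal_union_le _ _).trans ?_
      linarith [hcapψ x, hcapψ (-x)])
    (by positivity) (one_le_pow₀ hR.le) T (by linarith)
  have hx0 : ∀ i, 0 < ‖x i‖ := by
    intro i
    have := (hxA i).2
    rw [mem_ball_zero_iff, not_lt] at this
    linarith
  refine ⟨fun i => ⟨‖x i‖⁻¹ • x i, by
    rw [mem_sphere_zero_iff_norm]
    exact norm_smul_inv_norm (norm_pos_iff.1 (hx0 i))⟩, ?_, ?_⟩
  · intro i j hij
    have h1 := hxB i j hij
    simp only [Set.mem_union, Set.mem_ofPred_eq, not_or, not_le, angle_neg_left] at h1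
    simp only [sphereAngle]
    rw [angle_smul_left_of_pos _ _ (inv_pos.2 (hx0 i)),
      angle_smul_right_of_pos _ _ (inv_pos.2 (hx0 j))]
    exact ⟨h1.1.le, by linarith⟩
  · intro y
    set k := ({i : Fin T | y ∈ sphericalCap (⟨‖x i‖⁻¹ • x i, by
      rw [mem_sphere_zero_iff_norm]
      exact norm_smul_inv_norm (norm_pos_iff.1 (hx0 i))⟩ : UnitSphere n) φ}.ncard : ℕ)
    obtain ⟨p, hpP, hyp⟩ := hPnet y y.2
    have hy1 : ‖(y : EuclideanSpace ℝ (Fin n))‖ = 1 := mem_sphere_zero_iff_norm.1 y.2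
    have hp1 : ‖p‖ = 1 := mem_sphere_zero_iff_norm.1 (hPS hpP)
    have hangle : angle (y : EuclideanSpace ℝ (Fin n)) p ≤ δ := by
      refine angle_le_of_dist_le hδ.le hy1 hp1 ?_
      calc dist (y : EuclideanSpace ℝ (Fin n)) p ^ 2 ≤ √(2 - 2 * Real.cos δ) ^ 2 := by gcongr
        _ = _ := Real.sq_sqrt hρ.le
    -- Enlarging caps by `δ` moves the count from `y` to a net point.
    have hkle : k ≤ {i | x i ∈ {z | angle p z ≤ φ + δ}}.ncard := by
      refine Set.ncard_le_ncard ?_ (Set.toFinite _)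
      intro i hi
      simp only [Set.mem_ofPred_eq, sphericalCap, sphereAngle] at hi ⊢
      rw [angle_smul_left_of_pos _ _ (inv_pos.2 (hx0 i))] at hi
      rw [angle_comm]
      linarith [angle_le_angle_add_angle (x i) (y : EuclideanSpace ℝ (Fin n)) p]
    have h1 : (R ^ n) ^ k ≤ P.card * (1 + 2 * (R ^ n - 1) * (2 * Real.sin (φ + δ) ^ n)) ^ T := by
      refine le_trans ?_ hx
      refine le_trans (pow_le_pow_right₀ (one_le_pow₀ hR.le) hkle) ?_
      exact Finset.single_le_sum (f := fun p => (R ^ n) ^ {i | x i ∈ {z | angle p z ≤ φ + δ}}.ncard)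
        (fun p _ => by positivity) hpP
    have hbase : 0 ≤ 1 + 2 * (R ^ n - 1) * (2 * Real.sin (φ + δ) ^ n) := by
      nlinarith [pow_pos hsφ n, one_le_pow₀ hR.le (n := n)]
    have h2 : (1 + 2 * (R ^ n - 1) * (2 * Real.sin (φ + δ) ^ n)) ^ T ≤ Real.exp 4 := by
      have hRn : 1 ≤ R ^ n := one_le_pow₀ hR.le
      have h3 : 1 + 2 * (R ^ n - 1) * (2 * Real.sin (φ + δ) ^ n) ≤
          Real.exp (4 * (R * Real.sin (φ + δ)) ^ n) := by
        refine le_trans ?_ (Real.add_one_le_exp _)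
        rw [mul_pow]
        nlinarith [pow_pos hsφ n]
      calc _ ≤ Real.exp (4 * (R * Real.sin (φ + δ)) ^ n) ^ T :=
            pow_le_pow_left₀ hbase h3 T
        _ = Real.exp (T * (4 * (R * Real.sin (φ + δ)) ^ n)) := (Real.exp_nat_mul _ _).symm
        _ ≤ _ := Real.exp_le_exp.2 (by linarith)
    have h4 : (R ^ k) ^ n ≤ D ^ n := by
      calc (R ^ k) ^ n = (R ^ n) ^ k := pow_right_comm R k n
        _ ≤ (1 + 2 / √(2 - 2 * Real.cos δ)) ^ n * Real.exp 4 := by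
          exact h1.trans (mul_le_mul hPcard h2 (pow_nonneg hbase _) (by positivity))
        -- Weakening `exp 4` to an `n`-th power lets an `n`-th root be taken.
        _ ≤ (1 + 2 / √(2 - 2 * Real.cos δ)) ^ n * Real.exp 4 ^ n := by
          gcongr
          exact le_self_pow₀ (Real.one_le_exp (by norm_num)) (by omega)
        _ = ((1 + 2 / √(2 - 2 * Real.cos δ)) * Real.exp 4) ^ n := (mul_pow _ _ _).symm
        _ ≤ D ^ n := by gcongr
    have hD0 : 0 ≤ D := le_trans (by positivity) hD
    have h5 : R ^ k ≤ D := le_of_pow_le_pow_left₀ (by omega) hD0 h4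
    rw [le_div_iff₀ (Real.log_pos hR), ← Real.log_pow]
    exact Real.log_le_log (by positivity) h5

/-! ### Asymptotics and the choice of `N` -/

/-- Below the critical exponential growth rate `1 / sin φ`, families with bounded multiplicity
exist in all large dimensions. -/
theorem eventually_existsSpreadFamily {ψ φ β : ℝ} (hψ : 0 < ψ) (hψφ : ψ < φ)
    (hφ : φ < Real.pi / 2) (hβ : 0 < β) (hβφ : β * Real.sin φ < 1) :
    ∃ κ : ℝ, ∀ᶠ n : ℕ in atTop, ∀ T : ℕ, (T : ℝ) ≤ β ^ n → ExistsSpreadFamily ψ φ n T κ := by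
  have hπ := Real.pi_pos
  obtain ⟨φ', ⟨hφφ', hφ'⟩, hβφ'⟩ : ∃ φ', (φ < φ' ∧ φ' < Real.pi / 2) ∧ β * Real.sin φ' < 1 := by
    have h1 : ∀ᶠ a in 𝓝[>] φ, β * Real.sin a < 1 := by
      have : Tendsto (fun a => β * Real.sin a) (𝓝[>] φ) (𝓝 (β * Real.sin φ)) :=
        (by fun_prop : Continuous fun a => β * Real.sin a).continuousAt.tendsto.mono_left
          nhdsWithin_le_nhds
      exact this.eventually_lt_const hβφ
    have h2 : ∀ᶠ a in 𝓝[>] φ, a ∈ Set.Ioo φ (Real.pi / 2) := Ioo_mem_nhdsGT hφ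
    obtain ⟨a, ha, ha'⟩ := (h2.and h1).exists
    exact ⟨a, ha, ha'⟩
  have hsψ : 0 < Real.sin ψ := Real.sin_pos_of_pos_of_lt_pi hψ (by linarith)
  have hsφ' : 0 < Real.sin φ' := Real.sin_pos_of_pos_of_lt_pi (by linarith) (by linarith)
  have hβψ : β * Real.sin ψ < 1 := by
    have := Real.sin_lt_sin_of_lt_of_le_pi_div_two (by linarith) hφ'.le (hψφ.trans hφφ')
    nlinarith
  -- The slack in `β * sin φ' < 1` is spent on the base `R` of the potential.
  obtain ⟨R, hR, hRφ⟩ := exists_between (one_lt_inv₀ (by positivity) |>.2 hβφ' :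
    1 < (β * Real.sin φ')⁻¹)
  have hRq : R * (β * Real.sin φ') < 1 := by
    rwa [lt_inv_comm₀ (by linarith) (by positivity), lt_inv_comm₀ (by positivity) (by linarith),
      ← one_div, lt_div_iff₀ (by positivity)] at hRφ
  have hcos : Real.cos (2 * ψ) < 1 := by
    have := Real.cos_lt_cos_of_nonneg_of_le_pi le_rfl (by linarith : 2 * ψ ≤ Real.pi)
      (by linarith)
    rwa [Real.cos_zero] at this
  obtain ⟨t, ht, ht1⟩ := exists_between (max_lt hcos one_pos)
  obtain ⟨ht2, ht0⟩ := max_lt_iff.1 ht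
  refine ⟨Real.log ((1 + 2 / √(2 - 2 * Real.cos (φ' - φ))) * Real.exp 4) / Real.log R, ?_⟩
  have e1 : ∀ᶠ n : ℕ in atTop, t ^ n < 1 / 2 :=
    (tendsto_pow_atTop_nhds_zero_of_lt_one ht0.le ht1).eventually_lt_const (by norm_num)
  have e2 : ∀ᶠ n : ℕ in atTop, (β * Real.sin ψ) ^ n < 1 / 8 :=
    (tendsto_pow_atTop_nhds_zero_of_lt_one (by positivity) hβψ).eventually_lt_const (by norm_num)
  filter_upwards [e1, e2, eventually_ge_atTop 1] with n h1 h2 hn T hT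
  refine existsSpreadFamily_of_bounds (δ := φ' - φ) hψ hψφ (by linarith) (by linarith) ht0 ht2.le
    h1.le hR le_rfl hn ?_ ?_
  · calc T * Real.sin ψ ^ n ≤ β ^ n * Real.sin ψ ^ n := by gcongr
      _ = (β * Real.sin ψ) ^ n := (mul_pow _ _ _).symm
      _ ≤ _ := h2.le
  · rw [add_sub_cancel]
    calc T * (R * Real.sin φ') ^ n ≤ β ^ n * (R * Real.sin φ') ^ n := by gcongr
      _ = (R * (β * Real.sin φ')) ^ n := by rw [← mul_pow]; ring
      _ ≤ 1 := pow_le_one₀ (by positivity) hRq.le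

theorem one_le_mul_log_of_two_le {n : ℕ} (hn : 2 ≤ n) : 1 ≤ (n : ℝ) * Real.log n := by
  have h2 : (2 : ℝ) ≤ n := by exact_mod_cast hn
  have h3 : Real.log 2 ≤ Real.log n := Real.log_le_log (by norm_num) h2
  nlinarith [Real.log_two_gt_d9]

theorem tendsto_nat_mul_log_atTop : Tendsto (fun n : ℕ => (n : ℝ) * Real.log n) atTop atTop :=
  tendsto_natCast_atTop_atTop.atTop_mul_atTop₀
    (Real.tendsto_log_atTop.comp tendsto_natCast_atTop_atTop)

/-- The extra 1 absorbs the rounding in `⌊β ^ n⌋₊`. -/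
theorem eventually_pow_add_one_le_pow {a β : ℝ} (ha : 0 ≤ a) (haβ : a < β) (hβ : 1 < β) :
    ∀ᶠ n : ℕ in atTop, a ^ n + 1 ≤ β ^ n := by
  have h1 : ∀ᶠ n : ℕ in atTop, (a / β) ^ n < 1 / 2 :=
    (tendsto_pow_atTop_nhds_zero_of_lt_one (by positivity)
      ((div_lt_one (by linarith)).2 haβ)).eventually_lt_const (by norm_num)
  filter_upwards [h1, (tendsto_pow_atTop_atTop_of_one_lt hβ).eventually_ge_atTop 2] with n h h'
  rw [div_pow, div_lt_iff₀ (by positivity)] at h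
  linarith

theorem lemma2 (ψ φ : ℝ) (hψ : 0 < ψ) (hψφ : ψ < φ) (hφ : φ < Real.pi / 2) :
    ∃ (ε : ℕ → ℝ) (c : ℝ), Tendsto ε atTop (𝓝 0) ∧
      ∀ n : ℕ, 1 ≤ n →
        ∃ (N : ℕ) (x : Fin N → UnitSphere n),
          1 ≤ N ∧
          (N : ℝ) = ((1 + ε n) / Real.sin φ) ^ n ∧
          (∀ i j : Fin N, i < j →
            ψ ≤ sphereAngle (x i) (x j) ∧ sphereAngle (x i) (x j) ≤ Real.pi - ψ) ∧
          (2 ≤ n → ∀ y : UnitSphere n,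
            (({i : Fin N | y ∈ sphericalCap (x i) φ}.ncard : ℕ) : ℝ)
              ≤ c * ((n : ℝ) * Real.log (n : ℝ))) := by
  classical
  have hπ := Real.pi_pos
  have hs : 0 < Real.sin φ := Real.sin_pos_of_pos_of_lt_pi (by linarith) (by linarith)
  have hs1 : Real.sin φ < 1 := by
    have := Real.sin_lt_sin_of_lt_of_le_pi_div_two (by linarith) le_rfl hφ
    rwa [Real.sin_pi_div_two] at this
  set L := (Real.sin φ)⁻¹ with hL
  have hL1 : 1 < L := (one_lt_inv₀ hs).2 hs1
  -- The maximum with 1 keeps a single point admissible when `n = 1`, where `n log n = 0`.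
  let κ : ℕ → ℝ := fun n => max 1 (n * Real.log n)
  let N : ℕ → ℕ := fun n =>
    Nat.findGreatest (fun k => ExistsSpreadFamily ψ φ n k (κ n)) ⌊L ^ n⌋₊
  have hone : ∀ n, 1 ≤ n → 1 ≤ ⌊L ^ n⌋₊ ∧ ExistsSpreadFamily ψ φ n 1 (κ n) := fun n hn =>
    ⟨Nat.le_floor (by simpa using one_le_pow₀ hL1.le),
      (existsSpreadFamily_one ψ φ hn).mono (le_max_left _ _)⟩
  have hN1 : ∀ n, 1 ≤ n → 1 ≤ N n := fun n hn =>
    Nat.le_findGreatest (hone n hn).1 (hone n hn).2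
  have hNspec : ∀ n, 1 ≤ n → ExistsSpreadFamily ψ φ n (N n) (κ n) := fun n hn =>
    Nat.findGreatest_spec (P := fun k => ExistsSpreadFamily ψ φ n k (κ n)) (hone n hn).1
      (hone n hn).2
  have hNle : ∀ n, (N n : ℝ) ≤ L ^ n := fun n =>
    (Nat.cast_le.2 (Nat.findGreatest_le _)).trans (Nat.floor_le (by positivity))
  have hroot : ∀ n, 1 ≤ n → ((N n : ℝ) ^ (n : ℝ)⁻¹) ^ n = N n := fun n hn =>
    Real.rpow_inv_natCast_pow (Nat.cast_nonneg _) (by omega)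
  have hlim : Tendsto (fun n : ℕ => (N n : ℝ) ^ (n : ℝ)⁻¹) atTop (𝓝 L) := by
    rw [tendsto_order]
    constructor
    · intro a ha
      obtain ⟨β, hβ, hβL⟩ := exists_between (max_lt ha hL1)
      obtain ⟨haβ, hβ1⟩ := max_lt_iff.1 hβ
      have hβs : β * Real.sin φ < 1 := by
        rw [hL, ← one_div, lt_div_iff₀ hs] at hβL
        exact hβL
      obtain ⟨K, hK⟩ := eventually_existsSpreadFamily hψ hψφ hφ (by linarith) hβs
      filter_upwards [hK, tendsto_nat_mul_log_atTop.eventually_ge_atTop K, eventually_ge_atTop 1,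
        eventually_pow_add_one_le_pow (le_max_right a 0) (max_lt haβ (by linarith)) hβ1]
        with n h1 h2 hn h3
      have h4 : ⌊β ^ n⌋₊ ≤ N n := by
        refine Nat.le_findGreatest (Nat.floor_le_floor (by gcongr)) ?_
        exact (h1 _ (Nat.floor_le (by positivity))).mono (h2.trans (le_max_right _ _))
      have h5 : (max a 0) ^ n < N n := by
        have := Nat.lt_floor_add_one (β ^ n)
        have h4' : ((⌊β ^ n⌋₊ : ℕ) : ℝ) ≤ N n := by exact_mod_cast h4
        linarith
      rw [← hroot n hn] at h5
      exact (le_max_left a 0).trans_lt (lt_of_pow_lt_pow_left₀ n (by positivity) h5)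
    · intro b hb
      filter_upwards [eventually_ge_atTop 1] with n hn
      have h1 := hNle n
      rw [← hroot n hn] at h1
      exact (le_of_pow_le_pow_left₀ (by omega) (by positivity) h1).trans_lt hb
  refine ⟨fun n => (N n : ℝ) ^ (n : ℝ)⁻¹ * Real.sin φ - 1, 1, ?_, ?_⟩
  · have := (hlim.mul_const (Real.sin φ)).sub_const 1
    rwa [hL, inv_mul_cancel₀ hs.ne', sub_self] at this
  · intro n hn
    obtain ⟨x, h1, h2⟩ := hNspec n hn
    refine ⟨N n, x, hN1 n hn, ?_, h1, ?_⟩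
    · rw [add_sub_cancel, mul_div_cancel_right₀ _ hs.ne', hroot n hn]
    · intro hn2 y
      rw [one_mul]
      exact (h2 y).trans (max_le (one_le_mul_log_of_two_le hn2) le_rfl)
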